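/- **Definitions.** Players are $1,\dots,n$ ($n\ge 1$). A simple game declares every coalition $S\subseteq\{1,\dots,n\}$ winning or losing. It is a *canonical linear game* if it is monotonic (supersets of winning coalitions win) and replacing a player $q$ of a winning coalition by a player $p<q$ outside it always leaves it winning. A *direct left-shift* of $S$ is a coalition $(S\setminus\{p\})\cup\{p-1\}$ with $p\in S$, $p\geq 2$, $p-1\notin S$; *left-shifts* arise by repeating this, and *(direct) right-shifts* are defined symmetrically with $p+1$. In a canonical linear game, a *roof* (shift-minimal winning coalition) is a minimal winning coalition all of whose right-shifts other than itself are losing; a *ceiling* (shift-maximal losing coalition) is a maximal losing coalition all of whose left-shifts other than itself are winning. For $i\ge1$ and $0\le k\le 2^i-1$ let $S_{k,i}\subseteq\{1,\dots,4i\}$ be the coalition that, for each $j=1,\dots,i$, contains $4(j-1)+2$ and $4(j-1)+3$ if the $j$th bit of $k$ (written with $i$ binary digits, most significant first) is $0$, contains $4(j-1)+1$ and $4(j-1)+4$ if that bit is $1$, and contains no other players. The *$i$-bit roof game* $G_{i\text{-bit}}$ is the canonical linear game on $n=4i$ players whose set of roofs is $\{S_{0,i},\dots,S_{2^i-1,i}\}$.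 The strings of $\mathcal L_{\mathsf{roof}}$ (resp. $\mathcal L_{\mathsf{ceil}}$) are lists of characteristic vectors, each followed by an end mark; such a string represents a canonical linear game $G$ if the set of coalitions it lists is the set of all roofs (resp. ceilings) of $G$. In the $(\mathcal L_1,\mathcal L_2)$-voting game synthesis problem ($(\mathcal L_1,\mathcal L_2)$-VGS) one is given a string of $\mathcal L_1$ and must output a string of $\mathcal L_2$ representing the same game, or "no" if the game is not represented by any string of $\mathcal L_2$. Polynomial time means polynomially many steps of a Turing machine in the length of the input string. **Theorem.** 1. For every $i\ge1$ the game $G_{i\text{-bit}}$ is well defined: there is exactly one canonical linear game on $n=4i$ players with the set of roofs $\{S_{0,i},\dots,S_{2^i-1,i}\}$. It has exactly $2^i=2^{n/4}$ roofs. 2. No ceiling of $G_{i\text{-bit}}$ has more than two direct left-shifts. 3. $G_{i\text{-bit}}$ has $O(n^5)$ ceilings, where $n=4i$: there is a constant $c$ such that for all $i\ge 1$ the number of ceilings is at most $c\,n^5$. 4. There is no polynomial-time algorithm for $(\mathcal L_{\mathsf{ceil}},\mathcal L_{\mathsf{roof}})$-VGS, and there is none for $(\mathcal L_{\mathsf{roof}},\mathcal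 L_{\mathsf{ceil}})$-VGS. 5. In both problems the output can be exponentially larger than the input. There is a constant $c$ such that for every $i\ge1$, with $n=4i$, the game $G_{i\text{-bit}}$ has a representation in $\mathcal L_{\mathsf{ceil}}$ of length at most $c\,n^6$, while each of its representations in $\mathcal L_{\mathsf{roof}}$ has length at least $2^{n/4}$. There is likewise a constant $c$ such that for every $i\ge1$, with $n=4i$, some canonical linear game on $n$ players has a representation in $\mathcal L_{\mathsf{roof}}$ of length at most $c\,n^6$, while each of its representations in $\mathcal L_{\mathsf{ceil}}$ has length at least $2^{n/4}$. -/

import Mathlib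

/-- A simple game on the players `{1, …, n}`, player `p` being the element `p - 1` of `Fin n`.
A coalition `S` is winning if `v S = true` and losing if `v S = false`. -/
@[ext]
structure SimpleGame (n : ℕ) where
  v : Finset (Fin n) → Bool

/-- `T` is a direct left-shift of `S`: for some `i ∈ S` with `i - 1 ∉ S`, `T` is obtained from `S`
by replacing player `i` by player `i - 1`. -/
def IsDirectLeftShift {n : ℕ} (S T : Finset (Fin n)) : Prop :=
  ∃ i j : Fin n, (j : ℕ) + 1 = i ∧ i ∈ S ∧ j ∉ S ∧ T = insert j (S.erase i)

/-- `T` is a direct right-shift of `S`: for some `i ∈ S` with `i + 1 ∉ S`, `T` is obtained from `S`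
by replacing player `i` by player `i + 1`. -/
def IsDirectRightShift {n : ℕ} (S T : Finset (Fin n)) : Prop :=
  ∃ i j : Fin n, (i : ℕ) + 1 = j ∧ i ∈ S ∧ j ∉ S ∧ T = insert j (S.erase i)

/-- `T` is a left-shift of `S` (a coalition is a left-shift of itself, by the sequence of
length one). -/
def IsLeftShift {n : ℕ} (S T : Finset (Fin n)) : Prop :=
  Relation.ReflTransGen IsDirectLeftShift S T

/-- `T` is a right-shift of `S`. -/
def IsRightShift {n : ℕ} (S T : Finset (Fin n)) : Prop :=
  Relation.ReflTransGen IsDirectRightShift S T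

namespace SimpleGame

variable {n : ℕ}

def IsMonotonic (G : SimpleGame n) : Prop :=
  ∀ S T : Finset (Fin n), S ⊆ T → G.v S ≤ G.v T

/-- Player `i` is more desirable than player `j` (in the weak sense). -/
def MoreDesirable (G : SimpleGame n) (i j : Fin n) : Prop :=
  ∀ S : Finset (Fin n), i ∉ S → j ∉ S → G.v (insert j S) ≤ G.v (insert i S)

def IsLinear (G : SimpleGame n) : Prop :=
  G.IsMonotonic ∧ ∀ i j : Fin n, G.MoreDesirable i j ∨ G.MoreDesirable j i

/-- A linear game on at least one player in which player 1 is more desirable than player 2,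
player 2 more desirable than player 3, and so on. -/
def IsCanonicalLinear (G : SimpleGame n) : Prop :=
  0 < n ∧ G.IsLinear ∧ ∀ i j : Fin n, i ≤ j → G.MoreDesirable i j

def IsMinimalWinning (G : SimpleGame n) (S : Finset (Fin n)) : Prop :=
  G.v S = true ∧ ∀ i ∈ S, G.v (S.erase i) = false

def IsMaximalLosing (G : SimpleGame n) (S : Finset (Fin n)) : Prop :=
  G.v S = false ∧ ∀ i, i ∉ S → G.v (insert i S) = true

/-- A roof (shift-minimal winning) coalition: a minimal winning coalition all of whose right-shifts
(other than itself) are losing. -/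
def IsRoof (G : SimpleGame n) (S : Finset (Fin n)) : Prop :=
  G.IsMinimalWinning S ∧ ∀ T, IsRightShift S T → T ≠ S → G.v T = false

/-- A ceiling (shift-maximal losing) coalition: a maximal losing coalition all of whose left-shifts
(other than itself) are winning. -/
def IsCeiling (G : SimpleGame n) (S : Finset (Fin n)) : Prop :=
  G.IsMaximalLosing S ∧ ∀ T, IsLeftShift S T → T ≠ S → G.v T = true

end SimpleGame

/-- The `(k, i)`-encoding coalition. The `4 i` players are cut into `i` blocks of four; if the
`j`-th bit of the `i`-digit binary representation of `k` (most significant bit first) is `1`, it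
contains the first and the fourth player of the `j`-th block, otherwise the second and the third. -/
def encodingCoalition (i k : ℕ) : Finset (Fin (4 * i)) :=
  Finset.univ.filter fun p =>
    if k.testBit (i - 1 - (p : ℕ) / 4) then (p : ℕ) % 4 = 0 ∨ (p : ℕ) % 4 = 3
    else (p : ℕ) % 4 = 1 ∨ (p : ℕ) % 4 = 2

/-- `G` is the `i`-bit roof game: the canonical linear game on `4 i` players whose roof coalitions
are exactly the `(k, i)`-encoding coalitions, `0 ≤ k ≤ 2 ^ i - 1`. -/
def IsBitRoofGame (i : ℕ) (G : SimpleGame (4 * i)) : Prop :=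
  G.IsCanonicalLinear ∧
    ∀ S : Finset (Fin (4 * i)), G.IsRoof S ↔ ∃ k < 2 ^ i, S = encodingCoalition i k

/-- The alphabet of the representation languages: `some b` is the bit `b`, and `none` is the mark
that ends a characteristic vector. -/
abbrev RepSymbol : Type := Option Bool

def charVector {n : ℕ} (S : Finset (Fin n)) : List Bool :=
  List.ofFn fun p : Fin n => decide (p ∈ S)

/-- The string that writes out the characteristic vectors of a list of coalitions. -/
def encodeCoalitions {n : ℕ} (l : List (Finset (Fin n))) : List RepSymbol :=
  l.flatMap fun S => (charVector S).map some ++ [none]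

/-- A representation language, given by the relation "the string represents the game". Its strings
are those that represent some game; the class of games it defines consists of the games that are
represented by some string. -/
abbrev RepLanguage : Type := (n : ℕ) → SimpleGame n → List RepSymbol → Prop

/-- The strings of the language `L`. -/
def RepLanguage.Strings (L : RepLanguage) : Type :=
  {ℓ : List RepSymbol // ∃ (n : ℕ) (G : SimpleGame n), L n G ℓ}

/-- The roof language: lists of characteristic vectors of the roofs of a canonical linear game. -/
def roofLanguage : RepLanguage := fun n G ℓ =>
  G.IsCanonicalLinear ∧
    ∃ l : List (Finset (Fin n)), (∀ S, S ∈ l ↔ G.IsRoof S) ∧ ℓ = encodeCoalitions l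

/-- The ceiling language: lists of characteristic vectors of the ceilings of a canonical linear
game. -/
def ceilLanguage : RepLanguage := fun n G ℓ =>
  G.IsCanonicalLinear ∧
    ∃ l : List (Finset (Fin n)), (∀ S, S ∈ l ↔ G.IsCeiling S) ∧ ℓ = encodeCoalitions l

/-- `f` solves the `(L₁, L₂)`-voting game synthesis problem: on a string `ℓ` of `L₁` it returns a
string of `L₂` that represents the same game, and it answers "no" (`none`) only if the game
represented by `ℓ` is not in the class defined by `L₂`. -/
def SolvesVGS (L₁ L₂ : RepLanguage) (f : L₁.Strings → Option (List RepSymbol)) : Prop :=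
  ∀ ℓ : L₁.Strings,
    match f ℓ with
    | none => ∀ (n : ℕ) (G : SimpleGame n), L₁ n G ℓ.1 → ¬ ∃ ℓ', L₂ n G ℓ'
    | some ℓ' => ∃ (n : ℕ) (G : SimpleGame n), L₁ n G ℓ.1 ∧ L₂ n G ℓ'

/-- How an answer is written on the output tape: a string is written as it is, and "no" is written
as a symbol of its own. -/
def encodeAnswer : Option (List RepSymbol) → List (Option RepSymbol)
  | none => [none]
  | some ℓ => ℓ.map some

/-- There is a polynomial-time algorithm (a multi-stack Turing machine whose number of steps is
bounded by a polynomial in the length of the input string) for `(L₁, L₂)`-VGS. -/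
def VGSInPolyTime (L₁ L₂ : RepLanguage) : Prop :=
  ∃ f : L₁.Strings → Option (List RepSymbol), SolvesVGS L₁ L₂ f ∧
    Nonempty (Turing.TM2ComputableInPolyTime (fun ℓ : L₁.Strings => ℓ.1) encodeAnswer f)

/-! Order coalitions by domination: S lies below T when every initial segment of players holds at
least as many members of T as of S. The cover-type steps are direct left-shifts and added players
(`DominatedBy.exists_step`), so for n > 0 the canonical linear games are the up-sets of this order,
roofs are the minimal winning coalitions, ceilings the maximal losing ones, and complementation
exchanges the two through the dual game.

Each bit owns a block of four players holding two members, and it affects only the counts after the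
first and third places of its block, in opposite directions. Hence the 2^i codes form an antichain.
As bits are chosen independently, dominating some code is a conjunction over blocks
(`exists_encodingCoalition_dominatedBy_iff`). Losing thus means violating one of three conditions in
some block, and each violation has a greatest coalition, a stair coalition. So there are at most 3i
ceilings, each with at most two direct left-shifts, against 2^i roofs; the dual game reverses this.

A polynomial-time machine writes only polynomially long output, so it cannot list 2^i coalitions
from an input of length at most 3i(4i + 1). -/

/-! ### Prefix counts and the domination order. -/

section PrefixCard

variable {n : ℕ}

/-- The number of members of `S` among the first `p` players. -/
def prefixCard (S : Finset (Fin n)) (p : ℕ) : ℕ := (S.filter fun q : Fin n => (q : ℕ) < p).card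

theorem prefixCard_zero (S : Finset (Fin n)) : prefixCard S 0 = 0 := by simp [prefixCard]

theorem prefixCard_insert {S : Finset (Fin n)} {j : Fin n} (hj : j ∉ S) (p : ℕ) :
    prefixCard (insert j S) p = prefixCard S p + if (j : ℕ) < p then 1 else 0 := by
  unfold prefixCard
  rw [Finset.filter_insert]
  split_ifs with h
  · rw [Finset.card_insert_of_notMem (by simp [hj])]
  · simp

theorem prefixCard_erase {S : Finset (Fin n)} {i : Fin n} (hi : i ∈ S) (p : ℕ) :
    prefixCard (S.erase i) p + (if (i : ℕ) < p then 1 else 0) = prefixCard S p := by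
  rw [← prefixCard_insert (Finset.notMem_erase i S), Finset.insert_erase hi]

theorem prefixCard_swap {S : Finset (Fin n)} {i j : Fin n} (hi : i ∈ S) (hj : j ∉ S) (p : ℕ) :
    prefixCard (insert j (S.erase i)) p + (if (i : ℕ) < p then 1 else 0) =
      prefixCard S p + if (j : ℕ) < p then 1 else 0 := by
  rw [prefixCard_insert (fun h => hj (Finset.mem_of_mem_erase h)), ← prefixCard_erase hi p]
  omega

theorem prefixCard_succ (S : Finset (Fin n)) {p : ℕ} (hp : p < n) :
    prefixCard S (p + 1) = prefixCard S p + if (⟨p, hp⟩ : Fin n) ∈ S then 1 else 0 := by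
  unfold prefixCard
  split_ifs with h
  · rw [← Finset.card_insert_of_notMem (a := (⟨p, hp⟩ : Fin n)) (by simp)]
    congr 1
    ext q
    simp only [Finset.mem_filter, Finset.mem_insert, Fin.ext_iff]
    constructor
    · rintro ⟨h1, h2⟩
      by_cases h3 : (q : ℕ) = p
      · exact Or.inl h3
      · exact Or.inr ⟨h1, by omega⟩
    · rintro (h1 | ⟨h1, h2⟩)
      · obtain rfl : q = ⟨p, hp⟩ := Fin.ext h1
        exact ⟨h, by simp⟩
      · exact ⟨h1, by omega⟩
  · rw [add_zero]
    congr 1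
    ext q
    simp only [Finset.mem_filter]
    refine and_congr_right fun hq => ?_
    have : (q : ℕ) ≠ p := by
      rintro rfl
      exact h hq
    omega

theorem prefixCard_of_le (S : Finset (Fin n)) {p : ℕ} (hp : n ≤ p) :
    prefixCard S p = prefixCard S n := by
  unfold prefixCard
  congr 1
  ext q
  simp only [Finset.mem_filter]
  have := q.2
  constructor <;> rintro ⟨h, -⟩ <;> exact ⟨h, by omega⟩

theorem prefixCard_mono (S : Finset (Fin n)) {p q : ℕ} (h : p ≤ q) :
    prefixCard S p ≤ prefixCard S q :=
  Finset.card_le_card fun x hx => by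
    simp only [Finset.mem_filter] at hx ⊢
    exact ⟨hx.1, by omega⟩

theorem prefixCard_le_add (S : Finset (Fin n)) {p q : ℕ} (h : p ≤ q) :
    prefixCard S q ≤ prefixCard S p + (q - p) := by
  induction q, h using Nat.le_induction with
  | base => simp
  | succ q hq ih =>
    by_cases hn : q < n
    · rw [prefixCard_succ S hn]
      split_ifs <;> omega
    · rw [prefixCard_of_le S (by omega : n ≤ q + 1), ← prefixCard_of_le S (by omega : n ≤ q)]
      omega

theorem prefixCard_compl (S : Finset (Fin n)) {p : ℕ} (hp : p ≤ n) :
    prefixCard Sᶜ p + prefixCard S p = p := by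
  induction p with
  | zero => simp [prefixCard_zero]
  | succ p ih =>
    have := ih (by omega)
    rw [prefixCard_succ _ hp, prefixCard_succ _ hp]
    by_cases h : (⟨p, hp⟩ : Fin n) ∈ S <;> simp [h] <;> omega

/-- Every initial segment of players contains at least as many members of `T` as of `S`;
equivalently, `T` is obtained from `S` by left-shifts and by adding players. -/
def DominatedBy (S T : Finset (Fin n)) : Prop := ∀ p, prefixCard S p ≤ prefixCard T p

namespace DominatedBy

variable {S T U : Finset (Fin n)}

protected theorem refl (S : Finset (Fin n)) : DominatedBy S S := fun _ => le_rfl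

protected theorem trans (h : DominatedBy S T) (h' : DominatedBy T U) : DominatedBy S U :=
  fun p => (h p).trans (h' p)

theorem of_le (h : ∀ p ≤ n, prefixCard S p ≤ prefixCard T p) : DominatedBy S T := fun p => by
  rcases le_total p n with hp | hp
  · exact h p hp
  · rw [prefixCard_of_le S hp, prefixCard_of_le T hp]
    exact h n le_rfl

theorem of_subset (h : S ⊆ T) : DominatedBy S T := fun _ =>
  Finset.card_le_card (Finset.filter_subset_filter _ h)

protected theorem antisymm (h : DominatedBy S T) (h' : DominatedBy T S) : S = T := by
  ext ⟨p, hp⟩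
  have h1 := (h p).antisymm (h' p)
  have h2 := (h (p + 1)).antisymm (h' (p + 1))
  rw [prefixCard_succ S hp, prefixCard_succ T hp] at h2
  split_ifs at h2 with h3 h4 h4 <;> simp_all

theorem compl (h : DominatedBy S T) : DominatedBy Tᶜ Sᶜ := of_le fun p hp => by
  have := h p
  have := prefixCard_compl S hp
  have := prefixCard_compl T hp
  omega

theorem swap {i j : Fin n} (hi : i ∈ S) (hj : j ∉ S) (hji : j ≤ i) :
    DominatedBy S (insert j (S.erase i)) := fun p => by
  have := prefixCard_swap hi hj p
  have : (j : ℕ) ≤ i := hji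
  split_ifs at * <;> omega

theorem of_isDirectLeftShift (h : IsDirectLeftShift S T) : DominatedBy S T := by
  obtain ⟨i, j, hij, hi, hj, rfl⟩ := h
  exact swap hi hj (Fin.le_def.2 (by omega))

theorem of_isLeftShift (h : IsLeftShift S T) : DominatedBy S T := by
  induction h with
  | refl => exact .refl _
  | tail _ h ih => exact ih.trans (of_isDirectLeftShift h)

/-- If `T` strictly dominates `S`, then it dominates a coalition obtained from `S` by a direct
left-shift or by adding a player. -/
theorem exists_step (h : DominatedBy S T) (hne : S ≠ T) :
    ∃ S', (IsDirectLeftShift S S' ∨ ∃ i, i ∉ S ∧ S' = insert i S) ∧ S' ≠ S ∧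
      DominatedBy S' T := by
  classical
  have hex : ∃ p, prefixCard S p ≠ prefixCard T p := by
    by_contra! hc
    exact hne (DominatedBy.antisymm (fun p => (hc p).le) (fun p => (hc p).ge))
  -- Player `p` is the first place where membership differs: it belongs to `T` and not to `S`.
  obtain ⟨p, hp1, hp2⟩ :
      ∃ p, prefixCard S (p + 1) < prefixCard T (p + 1) ∧ prefixCard S p = prefixCard T p := by
    obtain ⟨p, hp⟩ : ∃ p, Nat.find hex = p + 1 :=
      Nat.exists_eq_succ_of_ne_zero fun h0 => Nat.find_spec hex (by simp [h0, prefixCard_zero])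
    refine ⟨p, lt_of_le_of_ne (h _) (hp ▸ Nat.find_spec hex), ?_⟩
    have := Nat.find_min hex (m := p) (by omega)
    tauto
  have hpn : p < n := by
    by_contra hc
    rw [prefixCard_of_le S (by omega : n ≤ p + 1), prefixCard_of_le T (by omega : n ≤ p + 1),
      ← prefixCard_of_le S (by omega : n ≤ p), ← prefixCard_of_le T (by omega : n ≤ p)] at hp1
    omega
  have hpS : (⟨p, hpn⟩ : Fin n) ∉ S := fun hc => by
    rw [prefixCard_succ S hpn, prefixCard_succ T hpn, if_pos hc] at hp1
    split_ifs at hp1 <;> omega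
  have hT : ∀ q, p < q → prefixCard S p + 1 ≤ prefixCard T q := fun q hq => by
    have h1 := prefixCard_mono T (show p + 1 ≤ q from hq)
    have h2 := prefixCard_mono S (show p ≤ p + 1 by omega)
    omega
  have hS : ∀ q, p ≤ q → (∀ r : Fin n, p ≤ r → (r : ℕ) < q → r ∉ S) →
      prefixCard S q = prefixCard S p := fun q hq hr => by
    unfold prefixCard
    congr 1
    ext x
    simp only [Finset.mem_filter]
    refine and_congr_right fun hx => ⟨fun hxq => ?_, fun hxp => by omega⟩
    by_contra hc
    exact hr x (by omega) hxq hx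
  -- If `S` has a member after `p`, the nearest one moves one place left. Only the prefix ending
  -- just before its old place gains, and there `S` still counts as many as at `p`, while `T` has at
  -- least one more.
  by_cases hq : ∃ q, p ≤ q ∧ ∃ hq : q < n, (⟨q, hq⟩ : Fin n) ∈ S
  · obtain ⟨hpq, hqn, hqS⟩ := Nat.find_spec hq
    have hmin : ∀ r : Fin n, p ≤ r → (r : ℕ) < Nat.find hq → r ∉ S := fun r hr hrq hrS =>
      Nat.find_min hq hrq ⟨hr, r.2, hrS⟩
    generalize Nat.find hq = q at *
    have hne' : q ≠ p := by
      rintro rfl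
      exact hpS hqS
    obtain ⟨j, rfl⟩ : ∃ j, q = j + 1 := ⟨q - 1, by omega⟩
    have hjS : (⟨j, by omega⟩ : Fin n) ∉ S := hmin _ (show p ≤ j by omega) (show j < j + 1 by omega)
    refine ⟨_, Or.inl ⟨⟨j + 1, hqn⟩, ⟨j, by omega⟩, rfl, hqS, hjS, rfl⟩, fun hc => ?_, fun r => ?_⟩
    · exact hjS ((Finset.ext_iff.1 hc _).1 (Finset.mem_insert_self _ _))
    · have h1 := prefixCard_swap hqS hjS r
      have h2 := h r
      by_cases hr : r = j + 1
      · subst hr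
        have := hS _ hpq hmin
        have := hT (j + 1) (by omega)
        simp at h1
        omega
      · simp only at h1
        split_ifs at h1 <;> omega
  -- With no member of `S` after `p`, its count stays constant from there on, so player `p` can be
  -- added.
  · push Not at hq
    refine ⟨_, Or.inr ⟨_, hpS, rfl⟩, fun hc => hpS (hc ▸ Finset.mem_insert_self _ _), fun r => ?_⟩
    rw [prefixCard_insert hpS]
    split_ifs with hr
    · rw [hS r hr.le fun q hq1 _ => hq q hq1 q.2]
      exact hT r hr
    · exact h r

end DominatedBy

/-- A rank function for domination. -/
def dominationRank (S : Finset (Fin n)) : ℕ := ∑ p ∈ Finset.range (n + 1), prefixCard S p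

theorem DominatedBy.dominationRank_lt {S T : Finset (Fin n)} (h : DominatedBy S T) (hne : S ≠ T) :
    dominationRank S < dominationRank T := by
  refine Finset.sum_lt_sum (fun p _ => h p) ?_
  by_contra! hc
  exact hne (h.antisymm (of_le fun p hp => hc p (by simp; omega)))

/-- Moving a member one place right moves a gap one place left; this is what makes duality exchange
roofs and ceilings. -/
theorem isDirectLeftShift_compl {S T : Finset (Fin n)} :
    IsDirectLeftShift Sᶜ Tᶜ ↔ IsDirectRightShift S T := by
  have key : ∀ i j : Fin n, i ∈ S → j ∉ S → (insert j (S.erase i))ᶜ = insert i (Sᶜ.erase j) := by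
    intro i j hi hj
    ext x
    have : i ≠ j := by
      rintro rfl
      exact hj hi
    simp only [Finset.mem_compl, Finset.mem_insert, Finset.mem_erase]
    by_cases h1 : x = i <;> by_cases h2 : x = j <;> simp_all
  constructor
  · rintro ⟨j, i, hij, hj, hi, h⟩
    simp only [Finset.mem_compl, not_not] at hj hi
    refine ⟨i, j, hij, hi, hj, ?_⟩
    rw [← key i j hi hj] at h
    exact compl_injective h
  · rintro ⟨i, j, hij, hi, hj, rfl⟩
    exact ⟨j, i, hij, by simpa using hj, by simpa using hi, key i j hi hj⟩

theorem isLeftShift_compl {S T : Finset (Fin n)} : IsLeftShift Sᶜ Tᶜ ↔ IsRightShift S T := by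
  constructor
  · intro h
    have := Relation.ReflTransGen.lift (p := IsDirectRightShift (n := n)) compl
      (fun a b hab => isDirectLeftShift_compl.1 (by simpa using hab)) _ _ h
    simpa [Function.onFun, IsRightShift] using this
  · exact fun h => Relation.ReflTransGen.lift compl
      (fun a b hab => isDirectLeftShift_compl.2 hab) _ _ h

end PrefixCard

/-! ### Canonical linear games as up-sets of domination, and duality. -/

namespace SimpleGame

variable {n : ℕ} {G H : SimpleGame n}

theorem IsCanonicalLinear.of_dominatedBy (hn : 0 < n)
    (h : ∀ S T, DominatedBy S T → G.v S ≤ G.v T) : G.IsCanonicalLinear := by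
  have hd : ∀ i j : Fin n, i ≤ j → G.MoreDesirable i j := by
    intro i j hij S hi hj
    refine h _ _ fun p => ?_
    rw [prefixCard_insert hi, prefixCard_insert hj]
    have : (i : ℕ) ≤ j := hij
    split_ifs <;> omega
  exact ⟨hn, ⟨fun S T hST => h _ _ (.of_subset hST),
    fun i j => (le_total i j).imp (hd i j) (hd j i)⟩, hd⟩

/-- Climb from `S` to `T` by the steps of `DominatedBy.exists_step`: desirability handles a
left-shift, monotonicity an added player, and the rank gap shrinks each time. -/
theorem IsCanonicalLinear.v_le (hG : G.IsCanonicalLinear) {S T : Finset (Fin n)}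
    (h : DominatedBy S T) : G.v S ≤ G.v T := by
  induction hk : dominationRank T - dominationRank S using Nat.strong_induction_on
    generalizing S with
  | _ k ih =>
    by_cases hne : S = T
    · rw [hne]
    obtain ⟨S', hS', hne', hd⟩ := h.exists_step hne
    have hle : DominatedBy S S' ∧ G.v S ≤ G.v S' := by
      rcases hS' with hS' | ⟨i, hi, rfl⟩
      · refine ⟨.of_isDirectLeftShift hS', ?_⟩
        obtain ⟨i, j, hij, hi, hj, rfl⟩ := hS'
        have := hG.2.2 j i (Fin.le_def.2 (by omega)) (S.erase i)
          (fun hc => hj (Finset.mem_of_mem_erase hc)) (Finset.notMem_erase _ _)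
        rwa [Finset.insert_erase hi] at this
      · exact ⟨.of_subset (Finset.subset_insert _ _), hG.2.1.1 _ _ (Finset.subset_insert _ _)⟩
    have h1 := hle.1.dominationRank_lt hne'.symm
    have h2 := h.dominationRank_lt hne
    exact hle.2.trans (ih _ (by omega) hd rfl)

theorem IsCanonicalLinear.v_eq_true (hG : G.IsCanonicalLinear) {S T : Finset (Fin n)}
    (h : DominatedBy S T) (hS : G.v S = true) : G.v T = true :=
  Bool.le_iff_imp.1 (hG.v_le h) hS

/-- Anything strictly above `S` dominates a one-step successor of `S`, so the local conditions in
the definition already give maximality among losing coalitions. -/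
theorem isCeiling_iff (hG : G.IsCanonicalLinear) (S : Finset (Fin n)) :
    G.IsCeiling S ↔ G.v S = false ∧ ∀ T, DominatedBy S T → T ≠ S → G.v T = true := by
  constructor
  · rintro ⟨⟨h1, h2⟩, h3⟩
    refine ⟨h1, fun T hT hne => ?_⟩
    obtain ⟨S', hS', hne', hd⟩ := hT.exists_step hne.symm
    have hw : G.v S' = true := by
      rcases hS' with hS' | ⟨i, hi, rfl⟩
      · exact h3 _ (.single hS') hne'
      · exact h2 i hi
    exact hG.v_eq_true hd hw
  · rintro ⟨h1, h2⟩
    refine ⟨⟨h1, fun i hi => h2 _ (.of_subset (Finset.subset_insert _ _))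
      fun hc => hi (hc ▸ Finset.mem_insert_self _ _)⟩, fun T hT => h2 T (.of_isLeftShift hT)⟩

/-- The dual game, in which a coalition wins if its complement loses in `G`. -/
def dual (G : SimpleGame n) : SimpleGame n := ⟨fun S => !G.v Sᶜ⟩

theorem dual_dual (G : SimpleGame n) : G.dual.dual = G := by
  ext S
  simp [dual]

theorem IsCanonicalLinear.dual (hG : G.IsCanonicalLinear) : G.dual.IsCanonicalLinear :=
  .of_dominatedBy hG.1 fun S T h => by
    have := hG.v_le h.compl
    simp only [SimpleGame.dual]
    revert this
    cases G.v Sᶜ <;> cases G.v Tᶜ <;> simp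

theorem isCeiling_dual_compl (S : Finset (Fin n)) : G.dual.IsCeiling Sᶜ ↔ G.IsRoof S := by
  have he : ∀ i, (insert i Sᶜ)ᶜ = S.erase i := fun i => by
    ext x
    simp
  unfold IsCeiling IsRoof IsMaximalLosing IsMinimalWinning
  simp only [dual, compl_compl, Bool.not_eq_eq_eq_not, Bool.not_false, Bool.not_true,
    Finset.mem_compl, not_not, he]
  refine and_congr_right fun _ => ⟨fun h T hT hne => ?_, fun h T hT hne => ?_⟩
  · simpa using h Tᶜ (isLeftShift_compl.2 hT) (by simpa using hne)
  · exact h Tᶜ (isLeftShift_compl.1 (by simpa using hT)) fun hc => hne (by simp [← hc])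

theorem isRoof_dual_compl (S : Finset (Fin n)) : G.dual.IsRoof Sᶜ ↔ G.IsCeiling S := by
  rw [← isCeiling_dual_compl, dual_dual, compl_compl]

theorem isRoof_iff (hG : G.IsCanonicalLinear) (S : Finset (Fin n)) :
    G.IsRoof S ↔ G.v S = true ∧ ∀ T, DominatedBy T S → T ≠ S → G.v T = false := by
  rw [← isCeiling_dual_compl, isCeiling_iff hG.dual]
  simp only [dual, compl_compl, Bool.not_eq_eq_eq_not, Bool.not_false, Bool.not_true]
  refine and_congr_right fun _ => ⟨fun h T hT hne => ?_, fun h T hT hne => ?_⟩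
  · simpa using h Tᶜ hT.compl (by simpa using hne)
  · exact h Tᶜ (by simpa using hT.compl) fun hc => hne (by simp [← hc])

theorem exists_roof_dominatedBy (hG : G.IsCanonicalLinear) {S : Finset (Fin n)}
    (hS : G.v S = true) : ∃ R, G.IsRoof R ∧ DominatedBy R S := by
  induction hk : dominationRank S using Nat.strong_induction_on generalizing S with
  | _ k ih =>
    by_cases hR : G.IsRoof S
    · exact ⟨S, hR, .refl S⟩
    rw [isRoof_iff hG] at hR
    push Not at hR
    obtain ⟨T, hT, hne, hv⟩ := hR hS
    obtain ⟨R, hR, hd⟩ := ih _ (by simpa [hk] using hT.dominationRank_lt hne)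
      (by simpa using hv) rfl
    exact ⟨R, hR, hd.trans hT⟩

theorem v_eq_true_iff (hG : G.IsCanonicalLinear) (S : Finset (Fin n)) :
    G.v S = true ↔ ∃ R, G.IsRoof R ∧ DominatedBy R S :=
  ⟨exists_roof_dominatedBy hG, fun ⟨_, hR, hd⟩ => hG.v_eq_true hd hR.1.1⟩

theorem eq_of_isRoof_iff (hG : G.IsCanonicalLinear) (hH : H.IsCanonicalLinear)
    (h : ∀ S, G.IsRoof S ↔ H.IsRoof S) : G = H := by
  ext S
  rw [Bool.eq_iff_iff, v_eq_true_iff hG, v_eq_true_iff hH]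
  simp only [h]

theorem eq_of_isCeiling_iff (hG : G.IsCanonicalLinear) (hH : H.IsCanonicalLinear)
    (h : ∀ S, G.IsCeiling S ↔ H.IsCeiling S) : G = H := by
  rw [← dual_dual G, ← dual_dual H, eq_of_isRoof_iff hG.dual hH.dual fun S => ?_]
  rw [← compl_compl S, isRoof_dual_compl, isRoof_dual_compl, h]

theorem ncard_isRoof_dual (G : SimpleGame n) :
    {S | G.dual.IsRoof S}.ncard = {S | G.IsCeiling S}.ncard := by
  rw [← Set.ncard_image_of_injective {S | G.IsCeiling S} compl_injective]
  congr 1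
  ext S
  simp only [Set.mem_ofPred_eq, Set.mem_image]
  constructor
  · intro h
    exact ⟨Sᶜ, by rwa [← isRoof_dual_compl, compl_compl], compl_compl S⟩
  · rintro ⟨T, hT, rfl⟩
    rwa [isRoof_dual_compl]

theorem ncard_isCeiling_dual (G : SimpleGame n) :
    {S | G.dual.IsCeiling S}.ncard = {S | G.IsRoof S}.ncard := by
  rw [← ncard_isRoof_dual, dual_dual]

end SimpleGame

/-! ### Greatest coalitions under bounds on two prefix counts. -/

section StairCoalition

/-- The players (numbered from `0`) below `b`, those from `a` to `e - 1`, and those from `c` on. -/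
def stairCoalition (n b a e c : ℕ) : Finset (Fin n) :=
  Finset.univ.filter fun p => (p : ℕ) < b ∨ (a ≤ (p : ℕ) ∧ (p : ℕ) < e) ∨ c ≤ (p : ℕ)

variable {n b a e c : ℕ}

theorem prefixCard_stairCoalition (hba : b ≤ a) (hae : a ≤ e) (hec : e ≤ c) {p : ℕ} (hp : p ≤ n) :
    prefixCard (stairCoalition n b a e c) p = min p b + (min p e - a) + (p - c) := by
  induction p with
  | zero => simp [prefixCard_zero]
  | succ p ih =>
    rw [prefixCard_succ _ hp, ih (by omega)]
    simp only [stairCoalition, Finset.mem_filter, Finset.mem_univ, true_and]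
    split_ifs <;> omega

/-- A prefix count is nondecreasing and grows by at most one per place. The stair coalition has the
largest counts these rules allow under the bounds at `a` and `c`. -/
theorem dominatedBy_stairCoalition (hba : b ≤ a) (hae : a ≤ e) (hec : e ≤ c)
    {S : Finset (Fin n)} (h1 : prefixCard S a ≤ b) (h2 : prefixCard S c ≤ b + (e - a)) :
    DominatedBy S (stairCoalition n b a e c) := .of_le fun p hp => by
  rw [prefixCard_stairCoalition hba hae hec hp]
  have h0 := prefixCard_le_add S (Nat.zero_le p)
  rw [prefixCard_zero] at h0
  rcases le_total p a with hpa | hpa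
  · have := prefixCard_mono S hpa
    omega
  · have := prefixCard_le_add S hpa
    rcases le_total p c with hpc | hpc
    · have := prefixCard_mono S hpc
      omega
    · have := prefixCard_le_add S hpc
      omega

/-- A shifted player must follow a gap, so it starts the second or the third run: it is `a` or `c`.
-/
theorem ncard_directLeftShift_stairCoalition (n b a e c : ℕ) :
    {T | IsDirectLeftShift (stairCoalition n b a e c) T}.ncard ≤ 2 := by
  classical
  let f : ℕ → Finset (Fin n) := fun p =>
    Finset.univ.filter fun q =>
      (q : ℕ) + 1 = p ∨ ((q : ℕ) ≠ p ∧ q ∈ stairCoalition n b a e c)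
  have hsub : {T | IsDirectLeftShift (stairCoalition n b a e c) T} ⊆
      (({f a, f c} : Finset _) : Set (Finset (Fin n))) := by
    rintro T ⟨i, j, hij, hi, hj, rfl⟩
    have hf : insert j ((stairCoalition n b a e c).erase i) = f i := by
      ext q
      simp only [f, Finset.mem_insert, Finset.mem_erase, Finset.mem_filter, Finset.mem_univ,
        true_and, Fin.ext_iff, ne_eq]
      have : (q : ℕ) = j ↔ (q : ℕ) + 1 = i := by omega
      rw [this]
    have hia : (i : ℕ) = a ∨ (i : ℕ) = c := by
      simp only [stairCoalition, Finset.mem_filter, Finset.mem_univ, true_and] at hi hj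
      omega
    rw [hf]
    rcases hia with h | h <;> simp [h]
  refine (Set.ncard_le_ncard hsub (Finset.finite_toSet _)).trans ?_
  rw [Set.ncard_coe_finset]
  exact Finset.card_le_two

end StairCoalition

/-! ### The bit roof game, its roofs and its ceilings. -/

section BitGame

theorem mem_encodingCoalition {i k j r : ℕ} (hr : r < 4) (h : 4 * j + r < 4 * i) :
    (⟨4 * j + r, h⟩ : Fin (4 * i)) ∈ encodingCoalition i k ↔
      if k.testBit (i - 1 - j) then r = 0 ∨ r = 3 else r = 1 ∨ r = 2 := by
  have h1 : (4 * j + r) / 4 = j := by omega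
  have h2 : (4 * j + r) % 4 = r := by omega
  simp [encodingCoalition, h1, h2]

theorem prefixCard_encodingCoalition_block {i k j : ℕ} (hj : j < i) :
    let P := prefixCard (encodingCoalition i k)
    let b := (k.testBit (i - 1 - j)).toNat
    P (4 * j + 1) = P (4 * j) + b ∧ P (4 * j + 2) = P (4 * j) + 1 ∧
      P (4 * j + 3) = P (4 * j) + (2 - b) ∧ P (4 * j + 4) = P (4 * j) + 2 := by
  intro P b
  have key : ∀ r < 4, P (4 * j + r + 1) = P (4 * j + r) +
      if (if k.testBit (i - 1 - j) then r = 0 ∨ r = 3 else r = 1 ∨ r = 2) then 1 else 0 := by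
    intro r hr
    have h : 4 * j + r < 4 * i := by omega
    simp only [P, prefixCard_succ _ h, mem_encodingCoalition hr h]
  have h0 := key 0 (by omega)
  have h1 := key 1 (by omega)
  have h2 := key 2 (by omega)
  have h3 := key 3 (by omega)
  change P (4 * j + 1) = P (4 * j) + _ at h0
  change P (4 * j + 2) = P (4 * j + 1) + _ at h1
  change P (4 * j + 3) = P (4 * j + 2) + _ at h2
  change P (4 * j + 4) = P (4 * j + 3) + _ at h3
  by_cases hb : k.testBit (i - 1 - j) <;> simp [b, hb] at h0 h1 h2 h3 ⊢ <;> omega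

theorem prefixCard_encodingCoalition {i k j : ℕ} (hj : j ≤ i) :
    prefixCard (encodingCoalition i k) (4 * j) = 2 * j := by
  induction j with
  | zero => simp [prefixCard_zero]
  | succ j ih =>
    have := (prefixCard_encodingCoalition_block (k := k) (show j < i by omega)).2.2.2
    rw [ih (by omega)] at this
    rw [show 4 * (j + 1) = 4 * j + 4 by ring]
    omega

theorem encodingCoalition_dominatedBy_iff {i k : ℕ} {S : Finset (Fin (4 * i))} :
    DominatedBy (encodingCoalition i k) S ↔ ∀ j < i,
      2 * j + (k.testBit (i - 1 - j)).toNat ≤ prefixCard S (4 * j + 1) ∧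
      2 * j + 1 ≤ prefixCard S (4 * j + 2) ∧
      2 * j + (2 - (k.testBit (i - 1 - j)).toNat) ≤ prefixCard S (4 * j + 3) ∧
      2 * j + 2 ≤ prefixCard S (4 * j + 4) := by
  constructor
  · intro h j hj
    obtain ⟨h1, h2, h3, h4⟩ := prefixCard_encodingCoalition_block (k := k) hj
    rw [prefixCard_encodingCoalition hj.le] at h1 h2 h3 h4
    rw [← h1, ← h2, ← h3, ← h4]
    exact ⟨h _, h _, h _, h _⟩
  · intro h
    refine .of_le fun p hp => ?_
    rcases Nat.eq_zero_or_pos p with rfl | hp0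
    · simp [prefixCard_zero]
    obtain ⟨j, r, hr, rfl⟩ : ∃ j r, r < 4 ∧ p = 4 * j + (r + 1) :=
      ⟨(p - 1) / 4, (p - 1) % 4, Nat.mod_lt _ (by omega), by omega⟩
    have hj : j < i := by omega
    obtain ⟨h1, h2, h3, h4⟩ := prefixCard_encodingCoalition_block (k := k) hj
    rw [prefixCard_encodingCoalition hj.le] at h1 h2 h3 h4
    obtain ⟨g1, g2, g3, g4⟩ := h j hj
    interval_cases r
    · exact h1.trans_le g1
    · exact h2.trans_le g2
    · exact h3.trans_le g3
    · exact h4.trans_le g4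

/-- A block with bit b has counts b and 2 - b after its first and third places. Domination bounds b
from both sides, so the bits agree. -/
theorem encodingCoalition_antichain {i k l : ℕ} (hk : k < 2 ^ i) (hl : l < 2 ^ i)
    (h : DominatedBy (encodingCoalition i k) (encodingCoalition i l)) : k = l := by
  refine Nat.eq_of_testBit_eq fun m => ?_
  rcases lt_or_ge m i with hm | hm
  · have hj : i - 1 - m < i := by omega
    obtain ⟨h1, -, h3, -⟩ := encodingCoalition_dominatedBy_iff.1 h _ hj
    obtain ⟨g1, -, g3, -⟩ := prefixCard_encodingCoalition_block (k := l) hj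
    rw [prefixCard_encodingCoalition hj.le] at g1 g3
    rw [g1] at h1
    rw [g3] at h3
    rw [show i - 1 - (i - 1 - m) = m by omega] at h1 h3
    revert h1 h3
    cases k.testBit m <;> cases l.testBit m <;> simp
  · have hle := Nat.pow_le_pow_right (n := 2) (by omega) hm
    rw [Nat.testBit_lt_two_pow (hk.trans_le hle), Nat.testBit_lt_two_pow (hl.trans_le hle)]

theorem encodingCoalition_injOn (i : ℕ) :
    Set.InjOn (encodingCoalition i) {k | k < 2 ^ i} := fun _ hk _ hl h =>
  encodingCoalition_antichain hk hl (h ▸ .refl _)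

/-- Each block's bit can be chosen by itself: bit 1 demands more at the first place, bit 0 more at
the third. The existential over 2^i codes thus becomes one disjunction per block. -/
theorem exists_encodingCoalition_dominatedBy_iff {i : ℕ} {S : Finset (Fin (4 * i))} :
    (∃ k < 2 ^ i, DominatedBy (encodingCoalition i k) S) ↔ ∀ j < i,
      2 * j + 1 ≤ prefixCard S (4 * j + 2) ∧ 2 * j + 2 ≤ prefixCard S (4 * j + 4) ∧
      (2 * j + 1 ≤ prefixCard S (4 * j + 1) ∨ 2 * j + 2 ≤ prefixCard S (4 * j + 3)) := by
  constructor
  · rintro ⟨k, -, h⟩ j hj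
    obtain ⟨h1, h2, h3, h4⟩ := encodingCoalition_dominatedBy_iff.1 h j hj
    refine ⟨h2, h4, ?_⟩
    revert h1 h3
    cases k.testBit (i - 1 - j) <;> simp <;> omega
  · intro h
    -- The bit is 1 exactly where the first-place demand is met. `Nat.ofBits` starts at the least
    -- significant bit, so bit `m` belongs to block `i - 1 - m`.
    let f : Fin i → Bool := fun m =>
      decide (2 * (i - 1 - m) + 1 ≤ prefixCard S (4 * (i - 1 - (m : ℕ)) + 1))
    refine ⟨Nat.ofBits f, Nat.ofBits_lt_two_pow f,
      encodingCoalition_dominatedBy_iff.2 fun j hj => ?_⟩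
    have hf : (Nat.ofBits f).testBit (i - 1 - j) =
        decide (2 * j + 1 ≤ prefixCard S (4 * j + 1)) := by
      rw [Nat.testBit_ofBits_lt f _ (by omega)]
      simp only [f]
      rw [show i - 1 - (i - 1 - j) = j by omega]
    obtain ⟨h1, h2, h3⟩ := h j hj
    -- With bit 0 the first-place demand is already met by the end of the preceding block.
    have h4 : 2 * j ≤ prefixCard S (4 * j + 1) := by
      rcases Nat.eq_zero_or_pos j with rfl | hj0
      · simp
      · have := (h (j - 1) (by omega)).2.1
        have := prefixCard_mono S (show 4 * (j - 1) + 4 ≤ 4 * j + 1 by omega)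
        omega
    have h5 := prefixCard_mono S (show 4 * j + 2 ≤ 4 * j + 3 by omega)
    rw [hf]
    by_cases hb : 2 * j + 1 ≤ prefixCard S (4 * j + 1) <;> simp [hb] <;> omega

open Classical in
/-- The game won by the coalitions that dominate an encoding coalition. -/
noncomputable def bitRoofGame (i : ℕ) : SimpleGame (4 * i) :=
  ⟨fun S => decide (∃ k < 2 ^ i, DominatedBy (encodingCoalition i k) S)⟩

theorem isBitRoofGame_bitRoofGame {i : ℕ} (hi : 1 ≤ i) : IsBitRoofGame i (bitRoofGame i) := by
  have hc : (bitRoofGame i).IsCanonicalLinear := .of_dominatedBy (by omega) fun S T h => by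
    rw [Bool.le_iff_imp]
    simp only [bitRoofGame, decide_eq_true_eq]
    rintro ⟨k, hk, hd⟩
    exact ⟨k, hk, hd.trans h⟩
  refine ⟨hc, fun S => ?_⟩
  rw [SimpleGame.isRoof_iff hc]
  simp only [bitRoofGame, decide_eq_true_eq, decide_eq_false_iff_not]
  constructor
  · rintro ⟨⟨k, hk, hd⟩, h⟩
    refine ⟨k, hk, ?_⟩
    by_contra hne
    exact h _ hd (Ne.symm hne) ⟨k, hk, .refl _⟩
  · rintro ⟨k, hk, rfl⟩
    refine ⟨⟨k, hk, .refl _⟩, ?_⟩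
    rintro T hT hne ⟨l, hl, hd⟩
    obtain rfl := encodingCoalition_antichain hl hk (hd.trans hT)
    exact hne (hT.antisymm hd)

namespace IsBitRoofGame

variable {i : ℕ} {G H : SimpleGame (4 * i)}

theorem unique (hG : IsBitRoofGame i G) (hH : IsBitRoofGame i H) : G = H :=
  SimpleGame.eq_of_isRoof_iff hG.1 hH.1 fun S => by rw [hG.2, hH.2]

theorem ncard_isRoof (hG : IsBitRoofGame i G) : {S | G.IsRoof S}.ncard = 2 ^ i := by
  have : {S | G.IsRoof S} = encodingCoalition i '' {k | k < 2 ^ i} := by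
    ext S
    simp only [Set.mem_ofPred_eq, hG.2, Set.mem_image, eq_comm]
  rw [this, (encodingCoalition_injOn i).ncard_image]
  have : {k | k < 2 ^ i} = ((Finset.range (2 ^ i) : Finset ℕ) : Set ℕ) := by
    ext
    simp
  rw [this, Set.ncard_coe_finset, Finset.card_range]

theorem v_eq_false_iff (hG : IsBitRoofGame i G) (S : Finset (Fin (4 * i))) :
    G.v S = false ↔ ∃ j < i,
      prefixCard S (4 * j + 2) ≤ 2 * j ∨ prefixCard S (4 * j + 4) ≤ 2 * j + 1 ∨
      (prefixCard S (4 * j + 1) ≤ 2 * j ∧ prefixCard S (4 * j + 3) ≤ 2 * j + 1) := by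
  have h : G.v S = true ↔ ∃ k < 2 ^ i, DominatedBy (encodingCoalition i k) S := by
    rw [SimpleGame.v_eq_true_iff hG.1]
    constructor
    · rintro ⟨R, hR, hd⟩
      obtain ⟨k, hk, rfl⟩ := (hG.2 R).1 hR
      exact ⟨k, hk, hd⟩
    · rintro ⟨k, hk, hd⟩
      exact ⟨_, (hG.2 _).2 ⟨k, hk, rfl⟩, hd⟩
  rw [← Bool.not_eq_true, h, exists_encodingCoalition_dominatedBy_iff]
  push Not
  refine exists_congr fun j => and_congr_right fun _ => ?_
  omega

/-- The greatest coalition violating the same condition as `C` also loses and dominates `C`, so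
maximality makes them equal. -/
theorem exists_eq_stairCoalition (hG : IsBitRoofGame i G) {C : Finset (Fin (4 * i))}
    (hC : G.IsCeiling C) : ∃ j < i, C = stairCoalition (4 * i) (2 * j) (4 * j + 2) (4 * j + 2)
      (4 * j + 2) ∨ C = stairCoalition (4 * i) (2 * j + 1) (4 * j + 4) (4 * j + 4) (4 * j + 4) ∨
      C = stairCoalition (4 * i) (2 * j) (4 * j + 1) (4 * j + 2) (4 * j + 3) := by
  rw [SimpleGame.isCeiling_iff hG.1] at hC
  have hmax : ∀ T, DominatedBy C T → G.v T = false → C = T := fun T hT hv => by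
    by_contra hne
    rw [hC.2 T hT (Ne.symm hne)] at hv
    cases hv
  obtain ⟨j, hj, h⟩ := (hG.v_eq_false_iff C).1 hC.1
  refine ⟨j, hj, ?_⟩
  rcases h with h | h | ⟨h, h'⟩
  · refine Or.inl (hmax _ (dominatedBy_stairCoalition (by omega) le_rfl le_rfl h
      (by omega)) ((hG.v_eq_false_iff _).2 ⟨j, hj, Or.inl ?_⟩))
    rw [prefixCard_stairCoalition (by omega) le_rfl le_rfl (by omega)]
    omega
  · refine Or.inr (Or.inl (hmax _ (dominatedBy_stairCoalition (by omega) le_rfl le_rfl h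
      (by omega)) ((hG.v_eq_false_iff _).2 ⟨j, hj, Or.inr (Or.inl ?_)⟩)))
    rw [prefixCard_stairCoalition (by omega) le_rfl le_rfl (by omega)]
    omega
  · refine Or.inr (Or.inr (hmax _ (dominatedBy_stairCoalition (by omega) (by omega) (by omega)
      h (by omega)) ((hG.v_eq_false_iff _).2 ⟨j, hj, Or.inr (Or.inr ?_)⟩)))
    rw [prefixCard_stairCoalition (by omega) (by omega) (by omega) (by omega),
      prefixCard_stairCoalition (by omega) (by omega) (by omega) (by omega)]
    omega

theorem ncard_directLeftShift_le (hG : IsBitRoofGame i G) {C : Finset (Fin (4 * i))}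
    (hC : G.IsCeiling C) : {T | IsDirectLeftShift C T}.ncard ≤ 2 := by
  obtain ⟨j, -, rfl | rfl | rfl⟩ := hG.exists_eq_stairCoalition hC <;>
    exact ncard_directLeftShift_stairCoalition _ _ _ _ _

theorem ncard_isCeiling_le (hG : IsBitRoofGame i G) : {S | G.IsCeiling S}.ncard ≤ 3 * i := by
  classical
  let F : ℕ → Finset (Finset (Fin (4 * i))) := fun j =>
    {stairCoalition (4 * i) (2 * j) (4 * j + 2) (4 * j + 2) (4 * j + 2),
      stairCoalition (4 * i) (2 * j + 1) (4 * j + 4) (4 * j + 4) (4 * j + 4),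
      stairCoalition (4 * i) (2 * j) (4 * j + 1) (4 * j + 2) (4 * j + 3)}
  have hsub : {S | G.IsCeiling S} ⊆
      (((Finset.range i).biUnion F : Finset _) : Set (Finset (Fin (4 * i)))) := fun C hC => by
    obtain ⟨j, hj, h⟩ := hG.exists_eq_stairCoalition hC
    simp only [Finset.coe_biUnion, Set.mem_iUnion, Finset.mem_coe, Finset.mem_range]
    exact ⟨j, hj, by simpa [F] using h⟩
  refine (Set.ncard_le_ncard hsub (Finset.finite_toSet _)).trans ?_
  rw [Set.ncard_coe_finset]
  simpa [mul_comm] using Finset.card_biUnion_le_card_mul (Finset.range i) F 3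
    fun j _ => Finset.card_le_three

end IsBitRoofGame

end BitGame

/-! ### Unique decoding and the length of representations. -/

section Representation

theorem length_encodeCoalitions {n : ℕ} (l : List (Finset (Fin n))) :
    (encodeCoalitions l).length = l.length * (n + 1) := by
  simp [encodeCoalitions, List.length_flatMap, charVector]

theorem charVector_injective (n : ℕ) : Function.Injective (charVector (n := n)) := fun S T h => by
  ext p
  simpa using congrFun (List.ofFn_injective h) p

theorem map_some_append_none_cons_inj {α : Type*} {a b : List α} {r s : List (Option α)}
    (h : a.map some ++ none :: r = b.map some ++ none :: s) : a = b ∧ r = s := by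
  induction a generalizing b with
  | nil => cases b <;> simp_all
  | cons x a ih =>
    cases b with
    | nil => simp at h
    | cons y b =>
      simp only [List.map_cons, List.cons_append, List.cons.injEq, Option.some.injEq] at h
      obtain ⟨rfl, h⟩ := h
      obtain ⟨rfl, rfl⟩ := ih h
      exact ⟨rfl, rfl⟩

theorem encodeCoalitions_cons {n : ℕ} (S : Finset (Fin n)) (l : List (Finset (Fin n))) :
    encodeCoalitions (S :: l) = (charVector S).map some ++ none :: encodeCoalitions l := by
  simp [encodeCoalitions]

theorem encodeCoalitions_injective (n : ℕ) :
    Function.Injective (encodeCoalitions (n := n)) := by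
  intro l
  induction l with
  | nil =>
    rintro (_ | ⟨S, l⟩) h
    · rfl
    · rw [encodeCoalitions_cons] at h
      simp [encodeCoalitions] at h
  | cons S l ih =>
    rintro (_ | ⟨T, m⟩) h
    · rw [encodeCoalitions_cons] at h
      simp [encodeCoalitions] at h
    · rw [encodeCoalitions_cons, encodeCoalitions_cons] at h
      obtain ⟨h1, h2⟩ := map_some_append_none_cons_inj h
      rw [charVector_injective n h1, ih h2]

/-- The number of players is read off the first vector. The empty list encodes to the empty string
for every `n`, hence `hl`. -/
theorem eq_of_encodeCoalitions_eq {n m : ℕ} {l : List (Finset (Fin n))}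
    {l' : List (Finset (Fin m))} (hl : l ≠ []) (h : encodeCoalitions l = encodeCoalitions l') :
    n = m := by
  obtain ⟨S, l, rfl⟩ := List.exists_cons_of_ne_nil hl
  rcases l' with _ | ⟨T, l'⟩
  · rw [encodeCoalitions_cons] at h
    simp [encodeCoalitions] at h
  · rw [encodeCoalitions_cons, encodeCoalitions_cons] at h
    simpa [charVector] using congrArg List.length (map_some_append_none_cons_inj h).1

/-- The language in which a canonical linear game is represented by the lists of the coalitions
with the property `P`. -/
def coalitionLanguage (P : ∀ n : ℕ, SimpleGame n → Finset (Fin n) → Prop) : RepLanguage :=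
  fun n G ℓ => G.IsCanonicalLinear ∧
    ∃ l : List (Finset (Fin n)), (∀ S, S ∈ l ↔ P n G S) ∧ ℓ = encodeCoalitions l

variable {P : ∀ n : ℕ, SimpleGame n → Finset (Fin n) → Prop} {n : ℕ} {G : SimpleGame n}

theorem exists_coalitionLanguage (hG : G.IsCanonicalLinear) :
    ∃ ℓ, coalitionLanguage P n G ℓ ∧ ℓ.length = {S | P n G S}.ncard * (n + 1) := by
  classical
  have hfin : {S | P n G S}.Finite := Set.toFinite _
  refine ⟨_, ⟨hG, hfin.toFinset.toList, fun S => ?_, rfl⟩, ?_⟩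
  · simp
  · rw [length_encodeCoalitions, Finset.length_toList, Set.ncard_eq_toFinset_card _ hfin]

theorem ncard_le_length_of_coalitionLanguage {ℓ : List RepSymbol}
    (h : coalitionLanguage P n G ℓ) : {S | P n G S}.ncard ≤ ℓ.length := by
  classical
  obtain ⟨-, l, hl, rfl⟩ := h
  have : {S | P n G S} = (l.toFinset : Set (Finset (Fin n))) := by
    ext S
    simp [hl]
  rw [this, Set.ncard_coe_finset, length_encodeCoalitions]
  exact (List.toFinset_card_le l).trans (Nat.le_mul_of_pos_right _ (by omega))

/-- A nonempty string represents at most one game, if games are determined by the coalitions with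
the property `P`. -/
theorem coalitionLanguage_unique
    (hP : ∀ {n : ℕ} {G H : SimpleGame n}, G.IsCanonicalLinear → H.IsCanonicalLinear →
      (∀ S, P n G S ↔ P n H S) → G = H)
    {m : ℕ} {H : SimpleGame m} {ℓ : List RepSymbol} (hne : ℓ ≠ [])
    (hG : coalitionLanguage P n G ℓ) (hH : coalitionLanguage P m H ℓ) :
    ∃ h : n = m, h ▸ G = H := by
  obtain ⟨hcG, l, hl, rfl⟩ := hG
  obtain ⟨hcH, l', hl', he⟩ := hH
  have hl0 : l ≠ [] := by
    rintro rfl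
    exact hne rfl
  obtain rfl := eq_of_encodeCoalitions_eq hl0 he
  obtain rfl := encodeCoalitions_injective n he
  exact ⟨rfl, hP hcG hcH fun S => by rw [← hl, ← hl']⟩

end Representation

/-! ### Polynomial time forces polynomially long output. -/

section PolyTime

open Turing

namespace Turing.TM2

variable {K : Type*} {Γ : K → Type*} {Λ σ : Type*}

/-- A bound on the number of symbols that one execution of a statement pushes. -/
def Stmt.pushBound : Stmt Γ Λ σ → ℕ
  | .push _ _ q => q.pushBound + 1
  | .peek _ _ q => q.pushBound
  | .pop _ _ q => q.pushBound
  | .load _ q => q.pushBound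
  | .branch _ q₁ q₂ => q₁.pushBound + q₂.pushBound
  | .goto _ => 0
  | .halt => 0

theorem length_stk_stepAux_le [DecidableEq K] (q : Stmt Γ Λ σ) (v : σ) (S : ∀ k, List (Γ k))
    (k : K) : ((stepAux q v S).stk k).length ≤ (S k).length + q.pushBound := by
  induction q generalizing v S with
  | push k' f q ih =>
    refine (ih v _).trans ?_
    by_cases h : k = k'
    · subst h
      simp only [Function.update_self, List.length_cons, Stmt.pushBound]
      omega
    · simp only [Function.update_of_ne h, Stmt.pushBound]
      omega
  | peek k' f q ih => exact ih _ _
  | pop k' f q ih =>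
    refine (ih _ _).trans ?_
    by_cases h : k = k'
    · subst h
      simp [Stmt.pushBound]
    · simp [Stmt.pushBound, Function.update_of_ne h]
  | load a q ih => exact ih _ _
  | branch f q₁ q₂ ih₁ ih₂ =>
    have h1 := ih₁ v S
    have h2 := ih₂ v S
    simp only [stepAux, Stmt.pushBound]
    cases f v
    · simp only [cond_false]
      omega
    · simp only [cond_true]
      omega
  | goto f => simp [stepAux]
  | halt => simp [stepAux]

end Turing.TM2

/-- One step executes the statement at one label, and there are finitely many labels; summing their
push bounds gives a growth rate valid for every step. -/
theorem Turing.FinTM2.exists_length_stk_le (tm : FinTM2) :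
    ∃ B : ℕ, ∀ (k : tm.K) (t : ℕ) (c d : tm.Cfg), (flip bind tm.step)^[t] (some c) = some d →
      (d.stk k).length ≤ (c.stk k).length + B * t := by
  have := tm.ΛFin
  refine ⟨∑ l : tm.Λ, (tm.m l).pushBound, fun k t => ?_⟩
  induction t with
  | zero =>
    intro c d h
    obtain rfl : c = d := by simpa using h
    simp
  | succ t ih =>
    intro c d h
    rw [Function.iterate_succ_apply'] at h
    obtain ⟨e, he, hd⟩ : ∃ e, (flip bind tm.step)^[t] (some c) = some e ∧ tm.step e = some d := by
      generalize (flip bind tm.step)^[t] (some c) = o at h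
      cases o with
      | none => cases h
      | some e => exact ⟨e, rfl, h⟩
    have h1 := ih c e he
    obtain ⟨_ | l, v, S⟩ := e
    · cases hd
    · obtain rfl : TM2.stepAux (tm.m l) v S = d := Option.some.inj hd
      have h2 := TM2.length_stk_stepAux_le (tm.m l) v S k
      have h3 : (tm.m l).pushBound ≤ ∑ l : tm.Λ, (tm.m l).pushBound :=
        Finset.single_le_sum (f := fun l => (tm.m l).pushBound) (fun _ _ => Nat.zero_le _)
          (Finset.mem_univ l)
      refine h2.trans ?_
      rw [mul_add, mul_one, ← add_assoc]
      exact add_le_add h1 h3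

/-- The output of a polynomial-time machine is polynomially long. -/
theorem Turing.TM2ComputableInPolyTime.exists_length_le {α β αΓ βΓ : Type} {ea : α → List αΓ}
    {eb : β → List βΓ} {f : α → β} (M : TM2ComputableInPolyTime ea eb f) :
    ∃ Q : Polynomial ℕ, ∀ a, (eb (f a)).length ≤ Q.eval (ea a).length := by
  obtain ⟨B, hB⟩ := M.tm.exists_length_stk_le
  refine ⟨Polynomial.X + Polynomial.C B * M.time, fun a => ?_⟩
  have h := M.outputsFun a
  have h1 := hB M.tm.k₁ h.steps _ _ h.evals_in_steps
  have h2 : ((initList M.tm (List.map M.inputAlphabet.invFun (ea a))).stk M.tm.k₁).length ≤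
      (ea a).length := by
    simp only [initList]
    -- The output stack may be the input stack, in which case it starts with the whole input;
    -- otherwise it starts empty.
    split_ifs with hk
    · generalize M.tm.k₁ = k at hk
      subst hk
      simp
    · simp
  have h3 : ((haltList M.tm (List.map M.outputAlphabet.invFun (eb (f a)))).stk M.tm.k₁).length =
      (eb (f a)).length := by
    simp [haltList]
  simp only [Polynomial.eval_add, Polynomial.eval_X, Polynomial.eval_mul, Polynomial.eval_C]
  rw [h3] at h1
  exact h1.trans (add_le_add h2 (Nat.mul_le_mul_left _ h.steps_le_m))

theorem Polynomial.exists_eval_lt_two_pow (Q : Polynomial ℕ) :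
    ∃ i, 1 ≤ i ∧ Q.eval i < 2 ^ i := by
  have h : (fun i : ℕ => ((Q.eval i : ℕ) : ℝ)) =o[Filter.atTop] fun i : ℕ => (2 : ℝ) ^ i := by
    induction Q using Polynomial.induction_on' with
    | add p q hp hq => simpa using hp.add hq
    | monomial d a =>
      simpa using (isLittleO_pow_const_const_pow_of_one_lt (R := ℝ) d
        (one_lt_two : (1 : ℝ) < 2)).const_mul_left (a : ℝ)
  have h1 := (h.def (show (0 : ℝ) < 1 / 2 by norm_num)).and (Filter.eventually_ge_atTop 1)
  obtain ⟨i, hi, hi1⟩ := h1.exists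
  refine ⟨i, hi1, ?_⟩
  have h2 : (0 : ℝ) < 2 ^ i := by positivity
  rw [Real.norm_of_nonneg (by positivity), Real.norm_of_nonneg h2.le] at hi
  have : ((Q.eval i : ℕ) : ℝ) < ((2 ^ i : ℕ) : ℝ) := by
    push_cast
    linarith
  exact_mod_cast this

theorem Polynomial.eval_nat_mono (Q : Polynomial ℕ) {a b : ℕ} (h : a ≤ b) :
    Q.eval a ≤ Q.eval b := by
  rw [Polynomial.eval_eq_sum, Polynomial.eval_eq_sum]
  exact Finset.sum_le_sum fun j _ => Nat.mul_le_mul_left _ (Nat.pow_le_pow_left h j)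

/-- Synthesis is not in polynomial time if some games have exponentially longer representations in
the second language than a string of polynomial length that represents them in the first. -/
theorem not_VGSInPolyTime_of_exponential {L₁ L₂ : RepLanguage} (R : Polynomial ℕ)
    (h : ∀ i : ℕ, 1 ≤ i → ∃ ℓ : L₁.Strings, ℓ.1.length ≤ R.eval i ∧
      ∀ (n : ℕ) (G : SimpleGame n), L₁ n G ℓ.1 →
        (∃ ℓ', L₂ n G ℓ') ∧ ∀ ℓ', L₂ n G ℓ' → 2 ^ i ≤ ℓ'.length) :
    ¬ VGSInPolyTime L₁ L₂ := by
  rintro ⟨f, hf, ⟨M⟩⟩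
  obtain ⟨Q, hQ⟩ := M.exists_length_le
  -- `Q` bounds the output by the input length and `R` the input length by `i`, so `Q.comp R` must
  -- be beaten by 2^i.
  obtain ⟨i, hi1, hi⟩ := (Q.comp R).exists_eval_lt_two_pow
  obtain ⟨ℓ, hℓ, hout⟩ := h i hi1
  have hle := (hQ ℓ).trans (Q.eval_nat_mono hℓ)
  rw [← Polynomial.eval_comp] at hle
  have hs := hf ℓ
  rcases hfl : f ℓ with _ | ℓ'
  · rw [hfl] at hs
    obtain ⟨n, G, hG⟩ := ℓ.2
    exact hs n G hG (hout n G hG).1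
  · rw [hfl] at hs hle
    obtain ⟨n, G, h1, h2⟩ := hs
    have := (hout n G h1).2 ℓ' h2
    simp only [encodeAnswer, List.length_map] at hle
    omega

end PolyTime

/-! ### Hardness of both conversions and the main theorem. -/

/-- Synthesis from the coalitions with property `P` to those with property `Q` is not in polynomial
time if there are games on `4 i` players with at most `3 i` coalitions of the first kind and at
least `2 ^ i` of the second. -/
theorem not_VGSInPolyTime_coalitionLanguage
    {P Q : ∀ n : ℕ, SimpleGame n → Finset (Fin n) → Prop}
    (hP : ∀ {n : ℕ} {G H : SimpleGame n}, G.IsCanonicalLinear → H.IsCanonicalLinear →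
      (∀ S, P n G S ↔ P n H S) → G = H)
    (h : ∀ i : ℕ, 1 ≤ i → ∃ G : SimpleGame (4 * i), G.IsCanonicalLinear ∧ (∃ S, P _ G S) ∧
      {S | P _ G S}.ncard ≤ 3 * i ∧ 2 ^ i ≤ {S | Q _ G S}.ncard) :
    ¬ VGSInPolyTime (coalitionLanguage P) (coalitionLanguage Q) := by
  refine not_VGSInPolyTime_of_exponential
    -- At most 3i vectors, each of 4i bits and an end mark.
    (Polynomial.C 3 * Polynomial.X * (Polynomial.C 4 * Polynomial.X + 1)) fun i hi => ?_
  obtain ⟨G, hG, ⟨S, hS⟩, hle, hge⟩ := h i hi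
  obtain ⟨ℓ, hℓ, hlen⟩ := exists_coalitionLanguage (P := P) hG
  refine ⟨⟨ℓ, _, G, hℓ⟩, ?_, fun m H hH => ?_⟩
  · simp only [Polynomial.eval_mul, Polynomial.eval_add, Polynomial.eval_C, Polynomial.eval_X,
      Polynomial.eval_one, hlen]
    exact Nat.mul_le_mul_right _ hle
  · have hne : ℓ ≠ [] := by
      rintro rfl
      have : 0 < {S | P _ G S}.ncard := (Set.ncard_pos (Set.toFinite _)).2 ⟨S, hS⟩
      have := Nat.mul_pos this (Nat.succ_pos (4 * i))
      simp at hlen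
      omega
    obtain ⟨rfl, rfl⟩ := coalitionLanguage_unique hP hne hℓ hH
    obtain ⟨ℓ', hℓ', -⟩ := exists_coalitionLanguage (P := Q) hG
    exact ⟨⟨ℓ', hℓ'⟩, fun ℓ'' h'' => hge.trans (ncard_le_length_of_coalitionLanguage h'')⟩

/-- This keeps the input string nonempty, so that it determines its game. The empty coalition loses,
so the full one wins in the dual game and dominates a roof there. -/
theorem IsBitRoofGame.exists_isCeiling {i : ℕ} {G : SimpleGame (4 * i)} (hG : IsBitRoofGame i G) :
    ∃ S, G.IsCeiling S := by
  have hi : 0 < i := by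
    have := hG.1.1
    omega
  have hlose : G.v ∅ = false := (hG.v_eq_false_iff ∅).2 ⟨0, hi, Or.inl (by simp [prefixCard])⟩
  obtain ⟨R, hR, -⟩ := SimpleGame.exists_roof_dominatedBy hG.1.dual
    (S := Finset.univ) (by simpa [SimpleGame.dual] using hlose)
  exact ⟨Rᶜ, by rwa [← SimpleGame.isRoof_dual_compl, compl_compl]⟩

theorem three_mul_mul_le_pow_six (i : ℕ) : 3 * i * (4 * i + 1) ≤ 1 * (4 * i) ^ 6 := by
  rcases Nat.eq_zero_or_pos i with rfl | hi
  · simp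
  · have h1 : (4 * i) ^ 2 ≤ (4 * i) ^ 6 := Nat.pow_le_pow_right (by omega) (by omega)
    nlinarith

theorem mainTheorem2 :
    -- the `i`-bit roof game is well defined
    (∀ i : ℕ, 1 ≤ i → ∃! G : SimpleGame (4 * i), IsBitRoofGame i G) ∧
    -- it has `2 ^ (n / 4) = 2 ^ i` roofs, and its ceilings have at most two direct left-shifts
    (∀ (i : ℕ) (G : SimpleGame (4 * i)), IsBitRoofGame i G →
      {S | G.IsRoof S}.ncard = 2 ^ i ∧
      ∀ C, G.IsCeiling C → {T | IsDirectLeftShift C T}.ncard ≤ 2) ∧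
    -- it has `O(n ^ 5)` ceilings, `n = 4 i`
    (∃ c : ℕ, ∀ (i : ℕ) (G : SimpleGame (4 * i)), IsBitRoofGame i G →
      {S | G.IsCeiling S}.ncard ≤ c * (4 * i) ^ 5) ∧
    -- there is no polynomial-time algorithm for either conversion
    ¬ VGSInPolyTime ceilLanguage roofLanguage ∧
    ¬ VGSInPolyTime roofLanguage ceilLanguage ∧
    -- for both conversions the output can be exponentially larger than the input
    (∃ c : ℕ, ∀ (i : ℕ) (G : SimpleGame (4 * i)), IsBitRoofGame i G →
      ∃ ℓ, ceilLanguage (4 * i) G ℓ ∧ ℓ.length ≤ c * (4 * i) ^ 6 ∧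
        ∀ ℓ', roofLanguage (4 * i) G ℓ' → 2 ^ i ≤ ℓ'.length) ∧
    (∃ c : ℕ, ∀ i : ℕ, 1 ≤ i → ∃ (G : SimpleGame (4 * i)) (ℓ : List RepSymbol),
      roofLanguage (4 * i) G ℓ ∧ ℓ.length ≤ c * (4 * i) ^ 6 ∧
        ∀ ℓ', ceilLanguage (4 * i) G ℓ' → 2 ^ i ≤ ℓ'.length) := by
  refine ⟨fun i hi => ⟨_, isBitRoofGame_bitRoofGame hi, fun H hH =>
      hH.unique (isBitRoofGame_bitRoofGame hi)⟩,
    fun i G hG => ⟨hG.ncard_isRoof, fun C hC => hG.ncard_directLeftShift_le hC⟩,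
    ⟨1, fun i G hG => hG.ncard_isCeiling_le.trans ?_⟩, ?_, ?_,
    ⟨1, fun i G hG => ?_⟩, ⟨1, fun i hi => ?_⟩⟩
  · have := Nat.le_self_pow (n := 5) (by omega) (4 * i)
    omega
  -- `ceilLanguage` and `roofLanguage` are instances of `coalitionLanguage` by unfolding.
  · exact not_VGSInPolyTime_coalitionLanguage (P := fun _ G => G.IsCeiling)
      (Q := fun _ G => G.IsRoof) SimpleGame.eq_of_isCeiling_iff fun i hi =>
        have hG := isBitRoofGame_bitRoofGame hi
        ⟨_, hG.1, hG.exists_isCeiling, hG.ncard_isCeiling_le, hG.ncard_isRoof.ge⟩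
  · refine not_VGSInPolyTime_coalitionLanguage (P := fun _ G => G.IsRoof)
      (Q := fun _ G => G.IsCeiling) SimpleGame.eq_of_isRoof_iff fun i hi => ?_
    have hG := isBitRoofGame_bitRoofGame hi
    obtain ⟨C, hC⟩ := hG.exists_isCeiling
    -- The dual game has at most 3i roofs and exactly 2^i ceilings.
    exact ⟨_, hG.1.dual, ⟨Cᶜ, (SimpleGame.isRoof_dual_compl C).2 hC⟩,
      (SimpleGame.ncard_isRoof_dual _).trans_le hG.ncard_isCeiling_le,
      (hG.ncard_isRoof.symm.trans (SimpleGame.ncard_isCeiling_dual _).symm).le⟩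
  · obtain ⟨ℓ, hℓ, hlen⟩ := exists_coalitionLanguage (P := fun _ G => G.IsCeiling) hG.1
    refine ⟨ℓ, hℓ, hlen.trans_le ((Nat.mul_le_mul_right _ hG.ncard_isCeiling_le).trans
      (three_mul_mul_le_pow_six i)), fun ℓ' hℓ' => ?_⟩
    exact hG.ncard_isRoof.ge.trans
      (ncard_le_length_of_coalitionLanguage (P := fun _ G => G.IsRoof) hℓ')
  · have hG := isBitRoofGame_bitRoofGame hi
    obtain ⟨ℓ, hℓ, hlen⟩ := exists_coalitionLanguage (P := fun _ G => G.IsRoof) hG.1.dual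
    refine ⟨_, ℓ, hℓ, hlen.trans_le ((Nat.mul_le_mul_right _
      ((SimpleGame.ncard_isRoof_dual _).trans_le hG.ncard_isCeiling_le)).trans
      (three_mul_mul_le_pow_six i)), fun ℓ' hℓ' => ?_⟩
    exact (hG.ncard_isRoof.symm.trans (SimpleGame.ncard_isCeiling_dual _).symm).le.trans
      (ncard_le_length_of_coalitionLanguage (P := fun _ G => G.IsCeiling) hℓ')
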